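/- Let $X$ be a complex Banach space and let $T$ be a bounded linear operator on $X$. Definitions. For a bounded operator $S$ on a Banach space $Y$ put $\alpha(S)=\dim\ker S$ and $\beta(S)=\dim Y/\operatorname{ran}S$. $S$ is upper semi-Fredholm if $\operatorname{ran}S$ is closed and $\alpha(S)<\infty$, lower semi-Fredholm if $\beta(S)<\infty$, and semi-Fredholm if it is one of the two; then its index is $\operatorname{ind}(S)=\alpha(S)-\beta(S)\in\mathbb Z\cup\{-\infty,+\infty\}$. $S$ is Fredholm if it is semi-Fredholm with $\operatorname{ind}(S)\in\mathbb Z$ (equivalently, $\alpha(S)<\infty$ and $\beta(S)<\infty$). $S$ is upper semi-Weyl if it is upper semi-Fredholm with $\operatorname{ind}(S)\le 0$, lower semi-Weyl if it is lower semi-Fredholm with $\operatorname{ind}(S)\ge 0$, and Weyl if it is Fredholm with $\operatorname{ind}(S)=0$. $S$ is quasi-nilpotent if its spectrum is contained in $\{0\}$ (so the operator on the zero space is quasi-nilpotent). Write $(M,N)\in\mathrm{Red}(T)$ if $M$ and $N$ are closed $T$-invariant subspaces of $X$ with $X=M\oplus N$, and let $T_M\colon M\to M$ and $T_N\colon N\to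 N$ be the restrictions of $T$. The operator $T$ is called upper pseudo semi-B-Fredholm (respectively lower pseudo semi-B-Fredholm, pseudo B-Fredholm, upper pseudo semi-B-Weyl, lower pseudo semi-B-Weyl, pseudo B-Weyl) if there is $(M,N)\in\mathrm{Red}(T)$ such that $T_N$ is quasi-nilpotent and $T_M$ is upper semi-Fredholm (respectively lower semi-Fredholm, Fredholm, upper semi-Weyl, lower semi-Weyl, Weyl). $T$ is pseudo semi-B-Fredholm if it is upper or lower pseudo semi-B-Fredholm; then its index $\operatorname{ind}(T)$ is defined as $\operatorname{ind}(T_M)$ for a pair $(M,N)\in\mathrm{Red}(T)$ such that $T_M$ is semi-Fredholm and $T_N$ is quasi-nilpotent (it does not depend on the choice of the pair). Proposition. The following statements hold. (i) $T$ is pseudo B-Fredholm if and only if $T$ is both upper pseudo semi-B-Fredholm and lower pseudo semi-B-Fredholm. (ii) $T$ is pseudo B-Weyl if and only if $T$ is both upper pseudo semi-B-Weyl and lower pseudo semi-B-Weyl. (iii) $T$ is pseudo B-Fredholm if and only if $T$ is pseudo semi-B-Fredholm and $\operatorname{ind}(T)\in\mathbb Z$. -/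

import Mathlib

noncomputable section

namespace PseudoFredholm

variable {X : Type*} [NormedAddCommGroup X] [NormedSpace ℂ X]

/-- The nullity `α(T)`: the dimension of the kernel, in `ℕ∞`. -/
def nullity (T : X →L[ℂ] X) : ℕ∞ :=
  Cardinal.toENat (Module.rank ℂ T.ker)

/-- The deficiency `β(T)`: the codimension of the range, in `ℕ∞`. -/
def deficiency (T : X →L[ℂ] X) : ℕ∞ :=
  Cardinal.toENat (Module.rank ℂ (X ⧸ T.range))

/-- The index `α(T) - β(T)`, an element of `ℤ ∪ {-∞, +∞}` whenever `T` is semi-Fredholm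
(it is used only for such `T`, for which at most one of the two terms is infinite). -/
def index (T : X →L[ℂ] X) : EReal :=
  (((nullity T : ℕ∞) : ENNReal) : EReal) - (((deficiency T : ℕ∞) : ENNReal) : EReal)

/-- Upper semi-Fredholm: closed range and finite-dimensional kernel. -/
structure IsUpperSemiFredholm (T : X →L[ℂ] X) : Prop where
  isClosed_range : IsClosed (T.range : Set X)
  finite_ker : FiniteDimensional ℂ T.ker

/-- Lower semi-Fredholm: range of finite codimension. -/
def IsLowerSemiFredholm (T : X →L[ℂ] X) : Prop :=
  FiniteDimensional ℂ (X ⧸ T.range)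

/-- Semi-Fredholm: upper or lower semi-Fredholm. -/
def IsSemiFredholm (T : X →L[ℂ] X) : Prop :=
  IsUpperSemiFredholm T ∨ IsLowerSemiFredholm T

theorem nullity_ne_top_iff (T : X →L[ℂ] X) : nullity T ≠ ⊤ ↔ FiniteDimensional ℂ T.ker := by
  rw [nullity, Ne, Cardinal.toENat_eq_top, not_le, Module.rank_lt_aleph0_iff]

theorem deficiency_ne_top_iff (T : X →L[ℂ] X) :
    deficiency T ≠ ⊤ ↔ FiniteDimensional ℂ (X ⧸ T.range) := by
  rw [deficiency, Ne, Cardinal.toENat_eq_top, not_le, Module.rank_lt_aleph0_iff]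

theorem exists_int_sub_eq_iff (a b : ℕ∞) (h : a ≠ ⊤ ∨ b ≠ ⊤) :
    (∃ n : ℤ, ((a : ENNReal) : EReal) - ((b : ENNReal) : EReal) = ((n : ℝ) : EReal)) ↔
      a ≠ ⊤ ∧ b ≠ ⊤ := by
  induction a using ENat.recTopCoe with
  | top =>
    induction b using ENat.recTopCoe with
    | top => simp at h
    | coe b => simp [sub_eq_add_neg]
  | coe a =>
    induction b using ENat.recTopCoe with
    | top => simp [sub_eq_add_neg]
    | coe b =>
      simp
      refine ⟨(a : ℤ) - b, ?_⟩
      push_cast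
      rfl

theorem isClosed_range_of_finite [CompleteSpace X] (T : X →L[ℂ] X) [FiniteDimensional ℂ T.ker]
    [FiniteDimensional ℂ (X ⧸ T.range)] : IsClosed (T.range : Set X) := by
  obtain ⟨E, hE, hc⟩ :=
    (Submodule.ClosedComplemented.of_finiteDimensional (𝕜 := ℂ) T.ker).exists_isClosed_isCompl
  obtain ⟨G, hG⟩ := T.range.exists_isCompl
  have : FiniteDimensional ℂ G := (Submodule.quotientEquivOfIsCompl _ _ hG).finiteDimensional
  have := hE.completeSpace_coe
  have hr : (T ∘L E.subtypeL).range = T.range := by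
    ext y
    constructor
    · rintro ⟨x, rfl⟩
      exact ⟨_, rfl⟩
    · rintro ⟨x, rfl⟩
      have : x ∈ T.ker ⊔ E := by
        rw [hc.sup_eq_top]
        trivial
      obtain ⟨k, hk, e, he, rfl⟩ := Submodule.mem_sup.1 this
      exact ⟨⟨e, he⟩, by simpa using hk⟩
  have hk : (T ∘L E.subtypeL).ker = ⊥ := by
    rw [eq_bot_iff]
    rintro ⟨x, hx⟩ h
    have h2 : x ∈ T.ker ⊓ E := ⟨h, hx⟩
    rw [hc.inf_eq_bot, Submodule.mem_bot] at h2
    simpa using h2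
  rw [← hr]
  exact ContinuousLinearMap.closed_complemented_range_of_isCompl_of_ker_eq_bot _ G (hr ▸ hG)
    (Submodule.closed_of_finiteDimensional G) hk

/-- On a Banach space, Mathlib's Fredholm operators are the semi-Fredholm operators with an
integer index. -/
theorem isFredholm_iff [CompleteSpace X] (T : X →L[ℂ] X) :
    T.IsFredholm ↔ IsSemiFredholm T ∧ ∃ n : ℤ, index T = ((n : ℝ) : EReal) := by
  have key : (IsSemiFredholm T ∧ ∃ n : ℤ, index T = ((n : ℝ) : EReal)) ↔
      FiniteDimensional ℂ T.ker ∧ FiniteDimensional ℂ (X ⧸ T.range) := by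
    rw [← nullity_ne_top_iff, ← deficiency_ne_top_iff]
    constructor
    · rintro ⟨h, h2⟩
      refine (exists_int_sub_eq_iff _ _ ?_).1 h2
      rw [nullity_ne_top_iff, deficiency_ne_top_iff]
      exact h.imp (fun h => h.finite_ker) id
    · rintro h
      exact ⟨Or.inr ((deficiency_ne_top_iff T).1 h.2), (exists_int_sub_eq_iff _ _ (Or.inl h.1)).2 h⟩
  rw [key]
  refine ⟨fun h => ⟨h.finite_ker, h.finite_coker⟩, fun ⟨h1, h2⟩ => ?_⟩
  have hcl := isClosed_range_of_finite T
  have := hcl.completeSpace_coe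
  have hs : Function.Surjective T.rangeRestrict := by
    rintro ⟨_, x, rfl⟩
    exact ⟨x, rfl⟩
  exact ⟨(T.rangeRestrict.isOpenMap hs).isQuotientMap T.rangeRestrict.continuous hs, hcl, h1, h2,
    .of_finiteDimensional _⟩

/-- Upper semi-Weyl: upper semi-Fredholm with nonpositive index. -/
def IsUpperSemiWeyl (T : X →L[ℂ] X) : Prop :=
  IsUpperSemiFredholm T ∧ index T ≤ 0

/-- Lower semi-Weyl: lower semi-Fredholm with nonnegative index. -/
def IsLowerSemiWeyl (T : X →L[ℂ] X) : Prop :=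
  IsLowerSemiFredholm T ∧ 0 ≤ index T

/-- Weyl: Fredholm of index zero. -/
def IsWeyl (T : X →L[ℂ] X) : Prop :=
  T.IsFredholm ∧ index T = 0

/-- Quasi-nilpotent: the spectrum contains no point other than `0`. (The spectrum is `{0}` when
the space is nonzero, and it is empty for the operator on the zero space, which is
quasi-nilpotent.) -/
def IsQuasinilpotent (T : X →L[ℂ] X) : Prop :=
  spectrum ℂ T ⊆ {0}

/-- `(M, N) ∈ Red(T)`: `M` and `N` are closed `T`-invariant subspaces with `X = M ⊕ N`. -/
structure Red (T : X →L[ℂ] X) (M N : Submodule ℂ X) : Prop where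
  isClosed_left : IsClosed (M : Set X)
  isClosed_right : IsClosed (N : Set X)
  mapsTo_left : ∀ x ∈ M, T x ∈ M
  mapsTo_right : ∀ x ∈ N, T x ∈ N
  isCompl : IsCompl M N

/-- The restriction `T_M : M → M`. -/
def Red.left {T : X →L[ℂ] X} {M N : Submodule ℂ X} (h : Red T M N) : M →L[ℂ] M :=
  T.restrict h.mapsTo_left

/-- The restriction `T_N : N → N`. -/
def Red.right {T : X →L[ℂ] X} {M N : Submodule ℂ X} (h : Red T M N) : N →L[ℂ] N :=
  T.restrict h.mapsTo_right

/-! Pseudo semi-B-Fredholm and pseudo semi-B-Weyl operators, through a pair `(M, N) ∈ Red(T)`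
with `T_N` quasi-nilpotent. -/

def IsUpperPseudoSemiBFredholm (T : X →L[ℂ] X) : Prop :=
  ∃ (M N : Submodule ℂ X) (h : Red T M N), IsUpperSemiFredholm h.left ∧ IsQuasinilpotent h.right

def IsLowerPseudoSemiBFredholm (T : X →L[ℂ] X) : Prop :=
  ∃ (M N : Submodule ℂ X) (h : Red T M N), IsLowerSemiFredholm h.left ∧ IsQuasinilpotent h.right

def IsPseudoBFredholm (T : X →L[ℂ] X) : Prop :=
  ∃ (M N : Submodule ℂ X) (h : Red T M N), h.left.IsFredholm ∧ IsQuasinilpotent h.right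

def IsUpperPseudoSemiBWeyl (T : X →L[ℂ] X) : Prop :=
  ∃ (M N : Submodule ℂ X) (h : Red T M N), IsUpperSemiWeyl h.left ∧ IsQuasinilpotent h.right

def IsLowerPseudoSemiBWeyl (T : X →L[ℂ] X) : Prop :=
  ∃ (M N : Submodule ℂ X) (h : Red T M N), IsLowerSemiWeyl h.left ∧ IsQuasinilpotent h.right

def IsPseudoBWeyl (T : X →L[ℂ] X) : Prop :=
  ∃ (M N : Submodule ℂ X) (h : Red T M N), IsWeyl h.left ∧ IsQuasinilpotent h.right

def IsPseudoSemiBFredholm (T : X →L[ℂ] X) : Prop :=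
  IsUpperPseudoSemiBFredholm T ∨ IsLowerPseudoSemiBFredholm T

theorem IsPseudoSemiBFredholm.exists_red {T : X →L[ℂ] X} (hT : IsPseudoSemiBFredholm T) :
    ∃ (M N : Submodule ℂ X) (h : Red T M N), IsSemiFredholm h.left ∧ IsQuasinilpotent h.right := by
  rcases hT with ⟨M, N, h, h1, h2⟩ | ⟨M, N, h, h1, h2⟩
  · exact ⟨M, N, h, Or.inl h1, h2⟩
  · exact ⟨M, N, h, Or.inr h1, h2⟩

/-- The index of a pseudo semi-B-Fredholm operator: the index of `T_M` for a pair
`(M, N) ∈ Red(T)` such that `T_M` is semi-Fredholm and `T_N` is quasi-nilpotent. On a Banach space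
it does not depend on the pair. -/
def pseudoIndex (T : X →L[ℂ] X) (hT : IsPseudoSemiBFredholm T) : EReal :=
  index hT.exists_red.choose_spec.choose_spec.choose.left

end PseudoFredholm

end

open Filter Topology

namespace PseudoFredholm

/-! The forward implications in (i) and (ii) keep the same pair. The converses must compare two
unrelated pairs `(M, N)` and `(M', N')`, and the link is `T - c` for small `c ≠ 0`. As `T_N - c` is
bijective, `T - c` and `T_M - c` have isomorphic kernels and cokernels (`Red.nonempty_ker_equiv`,
`Red.nonempty_coker_equiv`), so these spaces, up to isomorphism, do not depend on the pair.

Perturbation theory carries the information back to `c = 0`. Near an upper semi-Fredholm operator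
kernels stay finite-dimensional, and a nearby finite-dimensional cokernel forces one at the operator
itself (`eventually_upper`); `eventually_lower` is the dual statement. At a common `c`, an upper
pair and a lower pair thus make each other Fredholm. Local constancy of the index
(`eventually_index_eq`) makes their indices agree, which gives the Weyl case. For (iii), the pair
chosen in `pseudoIndex` is compared with a Fredholm pair. -/

theorem finiteDimensional_quotient_of_ker_le {K V W : Type*} [Field K] [AddCommGroup V]
    [Module K V] [AddCommMonoid W] [Module K W] [Module.Finite K W] (b : V →ₗ[K] Module.Dual K W)
    {p : Submodule K V} (hp : b.ker ≤ p) : FiniteDimensional K (V ⧸ p) := by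
  obtain ⟨n, s, hs⟩ := Module.Finite.exists_fin (R := K) (M := W)
  -- A functional on `W` is determined by its values on the finite spanning family `s`.
  let f : V →ₗ[K] Fin n → K := LinearMap.pi fun i => b.flip (s i)
  have hf : f.ker ≤ p := fun v hv => hp <| LinearMap.mem_ker.2 <|
    LinearMap.ext_on_range hs fun i => congrFun (LinearMap.mem_ker.1 hv) i
  have : FiniteDimensional K (V ⧸ f.ker) := f.quotKerEquivRange.symm.finiteDimensional
  exact Module.Finite.of_surjective _ (Submodule.factor_surjective hf)

/-! ### Stability of semi-Fredholm operators -/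

section Perturbation

variable {𝕜 : Type*} [RCLike 𝕜] {E F : Type*} [NormedAddCommGroup E] [NormedSpace 𝕜 E]
  [NormedAddCommGroup F] [NormedSpace 𝕜 F]

/-- Surjectivity of operators between Banach spaces is stable under small perturbations, with a
uniform bound for the preimages. -/
theorem exists_eventually_preimage_norm_le [CompleteSpace E] [CompleteSpace F] (A : E →L[𝕜] F)
    (hA : A.range = ⊤) :
    ∃ C : ℝ, 0 < C ∧ ∀ᶠ B in 𝓝 A, ∀ y : F, ∃ x : E, B x = y ∧ ‖x‖ ≤ C * ‖y‖ := by
  obtain ⟨A', hA'⟩ := A.exists_nonlinearRightInverse_of_surjective hA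
  have hC : (0 : ℝ) < A'.nnnorm := hA'
  refine ⟨2 * A'.nnnorm, by positivity, ?_⟩
  filter_upwards [Metric.ball_mem_nhds A (show (0 : ℝ) < (2 * (A'.nnnorm : ℝ))⁻¹ by positivity)]
    with B hB y
  rw [Metric.mem_ball, dist_eq_norm] at hB
  have happ : ApproximatesLinearOn B A Set.univ ‖B - A‖₊ := by
    intro x _ x' _
    simpa using (B - A).le_opNorm (x - x')
  -- The image of the ball of radius `ε` contains the ball of radius `(‖A'‖⁻¹ - ‖B - A‖) * ε`, which
  -- is at least `‖y‖` for this `ε`.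
  have hsurj := happ.surjOn_closedBall_of_nonlinearRightInverse A'
    (ε := 2 * A'.nnnorm * ‖y‖) (b := 0) (by positivity) (Set.subset_univ _)
  obtain ⟨x, hx, rfl⟩ := hsurj (a := y) (by
    rw [map_zero, mem_closedBall_zero_iff, coe_nnnorm]
    have h1 : (2 * A'.nnnorm : ℝ)⁻¹ ≤ (A'.nnnorm : ℝ)⁻¹ - ‖B - A‖ := by
      have : (A'.nnnorm : ℝ)⁻¹ = (2 * A'.nnnorm : ℝ)⁻¹ + (2 * A'.nnnorm : ℝ)⁻¹ := by
        field_simp; norm_num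
      linarith
    calc ‖y‖ = (2 * A'.nnnorm : ℝ)⁻¹ * (2 * A'.nnnorm * ‖y‖) := by field_simp
      _ ≤ _ := by gcongr)
  exact ⟨x, rfl, by simpa using hx⟩

theorem eventually_range_eq_top [CompleteSpace E] [CompleteSpace F] (A : E →L[𝕜] F)
    (hA : A.range = ⊤) : ∀ᶠ B in 𝓝 A, B.range = ⊤ := by
  obtain ⟨C, -, h⟩ := exists_eventually_preimage_norm_le A hA
  filter_upwards [h] with B hB
  exact LinearMap.range_eq_top.2 fun y => (hB y).imp fun _ hx => hx.1

/-- A subspace which lies close to a finite-dimensional subspace is finite-dimensional. -/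
theorem finiteDimensional_of_near (K L : Submodule 𝕜 E) [FiniteDimensional 𝕜 L] {r : ℝ}
    (hr : r < 1 / 8) (h : ∀ x ∈ K, ∃ y ∈ L, ‖x - y‖ ≤ r * ‖x‖) : FiniteDimensional 𝕜 K := by
  by_contra hK
  -- Riesz's lemma gives a bounded 1-separated sequence in `K`. Its approximants in `L` have two
  -- terms at distance below `1/2` by compactness, and two errors of at most `1/4` then contradict
  -- the separation.
  obtain ⟨f, hf1, hf2⟩ := exists_seq_norm_le_one_le_norm_sub'
    (𝕜 := 𝕜) (c := ((3 / 2 : ℝ) : 𝕜)) (R := 2)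
    (by rw [RCLike.norm_ofReal]; norm_num [abs_of_pos])
    (by rw [RCLike.norm_ofReal]; norm_num [abs_of_pos]) hK
  choose g hgL hg using fun n => h (f n) (f n).2
  have hg' (n : ℕ) : ‖(f n : E) - g n‖ ≤ 1 / 4 := by
    have h1 : ‖(f n : E)‖ ≤ 2 := hf1 n
    have h0 : 0 ≤ ‖(f n : E)‖ := norm_nonneg _
    nlinarith [hg n]
  have hb (n : ℕ) : (⟨g n, hgL n⟩ : L) ∈ Metric.closedBall (0 : L) 3 := by
    rw [mem_closedBall_zero_iff, Submodule.coe_norm]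
    have h1 : ‖(f n : E)‖ ≤ 2 := hf1 n
    have := norm_sub_norm_le (g n) (f n)
    rw [norm_sub_rev] at this
    linarith [hg' n]
  have : ProperSpace L := FiniteDimensional.proper 𝕜 L
  obtain ⟨a, -, φ, hφ, ha⟩ := (isCompact_closedBall (0 : L) 3).tendsto_subseq hb
  obtain ⟨N, hN⟩ := Metric.cauchySeq_iff.1 ha.cauchySeq (1 / 2) (by norm_num)
  have h1 := hN (N + 1) (by omega) N le_rfl
  have h2 : 1 ≤ ‖(f (φ (N + 1)) : E) - f (φ N)‖ := hf2 (hφ (Nat.lt_succ_self N)).ne'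
  have h3 : ‖g (φ (N + 1)) - g (φ N)‖ < 1 / 2 := by rwa [dist_eq_norm] at h1
  have h4 : (f (φ (N + 1)) : E) - f (φ N) = (f (φ (N + 1)) - g (φ (N + 1)))
      + (g (φ (N + 1)) - g (φ N)) - (f (φ N) - g (φ N)) := by abel
  have h5 := norm_sub_le ((f (φ (N + 1)) : E) - g (φ (N + 1)) + (g (φ (N + 1)) - g (φ N)))
    (f (φ N) - g (φ N))
  have h6 := norm_add_le ((f (φ (N + 1)) : E) - g (φ (N + 1))) (g (φ (N + 1)) - g (φ N))
  rw [h4] at h2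
  linarith [hg' (φ (N + 1)), hg' (φ N)]

/-- If the kernel of a surjective operator is infinite-dimensional, then so are the kernels of the
operators nearby. -/
theorem eventually_finiteDimensional_ker_imp [CompleteSpace E] [CompleteSpace F] (A : E →L[𝕜] F)
    (hA : A.range = ⊤) :
    ∀ᶠ B in 𝓝 A, FiniteDimensional 𝕜 B.ker → FiniteDimensional 𝕜 A.ker := by
  obtain ⟨C, hC, h⟩ := exists_eventually_preimage_norm_le A hA
  filter_upwards [h, Metric.ball_mem_nhds A (show (0 : ℝ) < (16 * C)⁻¹ by positivity)]
    with B hB hBA hfin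
  rw [Metric.mem_ball, dist_eq_norm] at hBA
  refine finiteDimensional_of_near A.ker B.ker (r := 1 / 16) (by norm_num) fun x hx => ?_
  -- On `A.ker` one has `B x = (B - A) x`, which is small, so subtracting a small preimage `z` of it
  -- moves `x` into `B.ker`.
  obtain ⟨z, hz, hzn⟩ := hB (B x)
  refine ⟨x - z, by simp [hz], ?_⟩
  have hx0 : A x = 0 := hx
  have h1 : ‖B x‖ ≤ (16 * C)⁻¹ * ‖x‖ := by
    have := (B - A).le_of_opNorm_le hBA.le x
    rwa [sub_apply, hx0, sub_zero] at this
  calc ‖x - (x - z)‖ = ‖z‖ := by rw [sub_sub_cancel]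
    _ ≤ C * ((16 * C)⁻¹ * ‖x‖) := hzn.trans (by gcongr)
    _ = 1 / 16 * ‖x‖ := by field_simp

/-- Lower semi-Fredholm operators under small perturbations. -/
theorem eventually_lower [CompleteSpace E] [CompleteSpace F] (T : E →L[𝕜] F)
    [FiniteDimensional 𝕜 (F ⧸ T.range)] :
    ∀ᶠ S in 𝓝 T, FiniteDimensional 𝕜 (F ⧸ S.range) ∧
      (FiniteDimensional 𝕜 S.ker → FiniteDimensional 𝕜 T.ker) := by
  -- Adjoining a finite-dimensional complement `G` of the range, `(x, g) ↦ S x + g`, reduces to the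
  -- surjective case.
  obtain ⟨G, hG⟩ := T.range.exists_isCompl
  have : FiniteDimensional 𝕜 G := (Submodule.quotientEquivOfIsCompl _ _ hG).finiteDimensional
  have hcont : Continuous fun S : E →L[𝕜] F => S.coprod G.subtypeL := by
    have : (fun S : E →L[𝕜] F => S.coprod G.subtypeL) = fun S =>
        S ∘L ContinuousLinearMap.fst 𝕜 E G + G.subtypeL ∘L ContinuousLinearMap.snd 𝕜 E G := by
      ext <;> simp
    rw [this]
    fun_prop
  have hT : (T.coprod G.subtypeL).range = ⊤ := by
    rw [ContinuousLinearMap.range_coprod]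
    simpa using hG.sup_eq_top
  filter_upwards [hcont.continuousAt.eventually (eventually_range_eq_top _ hT),
    hcont.continuousAt.eventually (eventually_finiteDimensional_ker_imp _ hT)] with S h1 h2
  constructor
  · refine Module.Finite.of_surjective (S.range.mkQ ∘ₗ G.subtype) fun y => ?_
    obtain ⟨y, rfl⟩ := S.range.mkQ_surjective y
    obtain ⟨⟨x, g⟩, hxg⟩ := LinearMap.range_eq_top.1 h1 y
    refine ⟨g, ?_⟩
    rw [← hxg]
    simp [Submodule.Quotient.mk_add]
  · intro hS
    have : FiniteDimensional 𝕜 (S.coprod G.subtypeL).ker := by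
      refine Module.Finite.iff_fg.2 ?_
      refine Submodule.fg_of_fg_map_of_fg_inf_ker (LinearMap.snd 𝕜 E G)
        (IsNoetherian.noetherian _) ?_
      have : (S.coprod G.subtypeL).ker ⊓ (LinearMap.snd 𝕜 E G).ker
          = S.ker.map (LinearMap.inl 𝕜 E G) := by
        ext ⟨x, g⟩
        simp
        aesop
      rw [this]
      exact (Module.Finite.iff_fg.1 hS).map _
    have := h2 this
    refine Module.Finite.of_injective ((LinearMap.inl 𝕜 E G).restrict (p := T.ker)
      (q := (T.coprod G.subtypeL).ker) fun x hx => ?_) ?_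
    · have hx0 : T x = 0 := hx
      simp [hx0]
    · intro x y hxy
      exact Subtype.ext (congrArg (fun z => z.1.1) hxy)

/-! ### Duality and the upper semi-Fredholm case -/

/-- The adjoint of a bounded operator between normed spaces. -/
noncomputable abbrev adjointMap (A : E →L[𝕜] F) : StrongDual 𝕜 F →L[𝕜] StrongDual 𝕜 E :=
  (ContinuousLinearMap.compL 𝕜 E F 𝕜).flip A

/-- A functional on `E` is carried to the closed range of `A` by the bounded inverse there, then
extended by Hahn–Banach. -/
theorem range_adjointMap_eq_top [CompleteSpace E] [CompleteSpace F] (A : E →L[𝕜] F)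
    (hA : Function.Injective A) (hc : IsClosed (Set.range A)) : (adjointMap A).range = ⊤ := by
  refine LinearMap.range_eq_top.2 fun f => ?_
  let e := A.equivRange hA hc
  obtain ⟨g, hg, -⟩ := exists_extension_norm_eq A.range (f ∘L (e.symm : A.range →L[𝕜] E))
  refine ⟨g, ?_⟩
  ext x
  have h1 : e x = ⟨A x, x, rfl⟩ := by
    apply Subtype.ext
    simp [e]
  have h2 := hg (e x)
  simp only [ContinuousLinearMap.comp_apply, ContinuousLinearEquiv.coe_coe,
    ContinuousLinearEquiv.symm_apply_apply] at h2
  rw [← h2, h1]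
  rfl

theorem injective_of_range_adjointMap_eq_top (A : E →L[𝕜] F) (hA : (adjointMap A).range = ⊤) :
    Function.Injective A := by
  refine (injective_iff_map_eq_zero A).2 fun x hx => ?_
  refine SeparatingDual.eq_zero_of_forall_dual_eq_zero (R := 𝕜) fun f => ?_
  obtain ⟨g, rfl⟩ := LinearMap.range_eq_top.1 hA f
  simp [hx]

/-- A functional killed by the adjoint factors through the cokernel. -/
theorem finiteDimensional_ker_adjointMap (A : E →L[𝕜] F) [FiniteDimensional 𝕜 (F ⧸ A.range)] :
    FiniteDimensional 𝕜 (adjointMap A).ker := by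
  let φ : (adjointMap A).ker →ₗ[𝕜] Module.Dual 𝕜 (F ⧸ A.range) :=
    { toFun f := A.range.liftQ (f.1 : F →ₗ[𝕜] 𝕜) (by
        rintro _ ⟨x, rfl⟩
        exact DFunLike.congr_fun f.2 x)
      map_add' f g := by ext; simp
      map_smul' c f := by ext; simp }
  refine Module.Finite.of_injective φ fun f g hfg => ?_
  ext y
  exact LinearMap.congr_fun hfg (A.range.mkQ y)

theorem finiteDimensional_coker_of_adjointMap (A : E →L[𝕜] F) (hc : IsClosed (A.range : Set F))
    [FiniteDimensional 𝕜 (adjointMap A).ker] : FiniteDimensional 𝕜 (F ⧸ A.range) := by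
  let ψ : F →ₗ[𝕜] Module.Dual 𝕜 (adjointMap A).ker :=
    LinearMap.mk₂ 𝕜 (fun y (f : (adjointMap A).ker) => f.1 y) (by simp) (by simp) (by simp)
      (by simp)
  have hψ : ψ.ker ≤ A.range := by
    intro y hy
    have : IsClosed (A.range : Set F) := hc
    -- Closedness of the range makes the quotient a normed space, whose points are separated by
    -- functionals; these pull back to the kernel of the adjoint.
    refine (Submodule.Quotient.mk_eq_zero _).1
      (SeparatingDual.eq_zero_of_forall_dual_eq_zero (R := 𝕜) fun g => ?_)
    have hg : adjointMap A (g ∘L A.range.mkQL) = 0 := by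
      ext x
      have : A.range.mkQL (A x) = 0 := (Submodule.Quotient.mk_eq_zero _).2 ⟨x, rfl⟩
      simp [this]
    exact LinearMap.congr_fun (LinearMap.mem_ker.1 hy) ⟨g ∘L A.range.mkQL, hg⟩
  exact finiteDimensional_quotient_of_ker_le ψ hψ

/-- Upper semi-Fredholm operators under small perturbations. -/
theorem eventually_upper [CompleteSpace E] [CompleteSpace F] (T : E →L[𝕜] F)
    [FiniteDimensional 𝕜 T.ker] (hc : IsClosed (T.range : Set F)) :
    ∀ᶠ S in 𝓝 T, FiniteDimensional 𝕜 S.ker ∧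
      (FiniteDimensional 𝕜 (F ⧸ S.range) → FiniteDimensional 𝕜 (F ⧸ T.range)) := by
  -- On a closed complement `M` of the kernel, `T` is injective with the same closed range, so the
  -- adjoint of its restriction is surjective and the surjective case applies to it.
  obtain ⟨M, hM, hKM⟩ :=
    (Submodule.ClosedComplemented.of_finiteDimensional (𝕜 := 𝕜) T.ker).exists_isClosed_isCompl
  have := hM.completeSpace_coe
  have hfin : FiniteDimensional 𝕜 (E ⧸ M) :=
    (Submodule.quotientEquivOfIsCompl _ _ hKM.symm).symm.finiteDimensional
  have hr : (T ∘L M.subtypeL).range = T.range := by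
    ext y
    constructor
    · rintro ⟨x, rfl⟩
      exact ⟨_, rfl⟩
    · rintro ⟨x, rfl⟩
      obtain ⟨k, hk, e, he, rfl⟩ := Submodule.mem_sup.1
        (show x ∈ T.ker ⊔ M by rw [hKM.sup_eq_top]; trivial)
      exact ⟨⟨e, he⟩, by simpa using hk⟩
  have hinj : Function.Injective (T ∘L M.subtypeL) := by
    refine (injective_iff_map_eq_zero _).2 fun x hx => ?_
    have h2 : (x : E) ∈ T.ker ⊓ M := ⟨hx, x.2⟩
    rw [hKM.inf_eq_bot, Submodule.mem_bot] at h2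
    simpa using h2
  have hcont : Continuous fun S : E →L[𝕜] F => adjointMap (S ∘L M.subtypeL) := by fun_prop
  have hsurj := range_adjointMap_eq_top (T ∘L M.subtypeL) hinj (by
    rw [← hr] at hc
    exact hc)
  filter_upwards [hcont.continuousAt.eventually (eventually_range_eq_top _ hsurj),
    hcont.continuousAt.eventually (eventually_finiteDimensional_ker_imp _ hsurj)] with S h1 h2
  constructor
  · have := injective_of_range_adjointMap_eq_top _ h1
    -- Since `S` is injective on `M`, its kernel embeds in the finite-dimensional `E ⧸ M`.
    refine Module.Finite.of_injective (M.mkQ ∘ₗ S.ker.subtype)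
      ((injective_iff_map_eq_zero _).2 fun x hx => ?_)
    have hxM : (x : E) ∈ M := by simpa using hx
    have hx0 : S x = 0 := x.2
    have := (injective_iff_map_eq_zero _).1 this ⟨x, hxM⟩ hx0
    simpa using this
  · intro hS
    have : FiniteDimensional 𝕜 (F ⧸ (S ∘L M.subtypeL).range) := by
      rw [ContinuousLinearMap.toLinearMap_comp, LinearMap.range_comp]
      have : FiniteDimensional 𝕜 (E ⧸ M.subtypeL.range) := by
        rwa [Submodule.toLinearMap_subtypeL, Submodule.range_subtype]
      infer_instance
    have := h2 (finiteDimensional_ker_adjointMap _)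
    rw [← hr]
    exact finiteDimensional_coker_of_adjointMap _ (by rwa [hr])

end Perturbation

/-! ### Local constancy of the Fredholm index -/

section Index

variable {𝕜 : Type*} [RCLike 𝕜] {E F : Type*} [NormedAddCommGroup E] [NormedSpace 𝕜 E]
  [NormedAddCommGroup F] [NormedSpace 𝕜 F]

/-- Stability of the index of Fredholm operators under small perturbations. -/
theorem eventually_index_eq [CompleteSpace E] [CompleteSpace F] (T : E →L[𝕜] F)
    [FiniteDimensional 𝕜 T.ker] [FiniteDimensional 𝕜 (F ⧸ T.range)]
    (hc : IsClosed (T.range : Set F)) :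
    ∀ᶠ S in 𝓝 T, FiniteDimensional 𝕜 S.ker ∧ FiniteDimensional 𝕜 (F ⧸ S.range) ∧
      S.toLinearMap.index = T.toLinearMap.index := by
  obtain ⟨M, hM, hKM⟩ :=
    (Submodule.ClosedComplemented.of_finiteDimensional (𝕜 := 𝕜) T.ker).exists_isClosed_isCompl
  have := hM.completeSpace_coe
  obtain ⟨G, hG⟩ := T.range.exists_isCompl
  have : FiniteDimensional 𝕜 G := (Submodule.quotientEquivOfIsCompl _ _ hG).finiteDimensional
  have hfin : FiniteDimensional 𝕜 (E ⧸ M) :=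
    (Submodule.quotientEquivOfIsCompl _ _ hKM.symm).symm.finiteDimensional
  have : CompleteSpace G := FiniteDimensional.complete 𝕜 G
  -- `J T` is an isomorphism, hence so is `J S` for `S` near `T`.
  let J : (E →L[𝕜] F) → (M × G →L[𝕜] F) := fun S => (S ∘L M.subtypeL).coprod G.subtypeL
  have hJ : Continuous J := by
    have : J = fun S =>
        (S ∘L M.subtypeL) ∘L ContinuousLinearMap.fst 𝕜 M G
          + G.subtypeL ∘L ContinuousLinearMap.snd 𝕜 M G := by
      ext <;> simp [J]
    rw [this]
    fun_prop
  have hinj : (J T).ker = ⊥ := by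
    refine LinearMap.ker_eq_bot'.2 ?_
    rintro ⟨m, g⟩ h
    have h1 : T m + g = 0 := h
    have hg : (g : F) ∈ T.range ⊓ G :=
      ⟨⟨-m, by rw [map_neg]; exact neg_eq_of_add_eq_zero_right h1⟩, g.2⟩
    rw [hG.inf_eq_bot, Submodule.mem_bot] at hg
    rw [hg, add_zero] at h1
    have hm : (m : E) ∈ T.ker ⊓ M := ⟨h1, m.2⟩
    rw [hKM.inf_eq_bot, Submodule.mem_bot] at hm
    exact Prod.ext (Subtype.ext hm) (Subtype.ext hg)
  have hsurj : (J T).range = ⊤ := by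
    refine LinearMap.range_eq_top.2 fun y => ?_
    obtain ⟨_, ⟨x, rfl⟩, g, hg, rfl⟩ := Submodule.mem_sup.1
      (show y ∈ T.range ⊔ G by rw [hG.sup_eq_top]; trivial)
    obtain ⟨k, hk, m, hm, rfl⟩ := Submodule.mem_sup.1
      (show x ∈ T.ker ⊔ M by rw [hKM.sup_eq_top]; trivial)
    have hk0 : T k = 0 := hk
    exact ⟨(⟨m, hm⟩, ⟨g, hg⟩), by simp [J, hk0]⟩
  have hM1 : FiniteDimensional 𝕜 M.subtype.ker := by
    rw [Submodule.ker_subtype]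
    infer_instance
  have hM2 : FiniteDimensional 𝕜 (E ⧸ M.subtype.range) := by
    rwa [Submodule.range_subtype]
  have hi1 : FiniteDimensional 𝕜 (LinearMap.inl 𝕜 M G).ker := by
    rw [LinearMap.ker_eq_bot.2 LinearMap.inl_injective]
    infer_instance
  have hi2 : FiniteDimensional 𝕜 ((M × G) ⧸ (LinearMap.inl 𝕜 M G).range) := by
    rw [LinearMap.range_inl]
    exact (LinearMap.quotKerEquivOfSurjective _ LinearMap.snd_surjective).symm.finiteDimensional
  -- Restricting `S` to `M` equals `J S` after `inl`; additivity of the index then expresses that of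
  -- `S` by terms independent of `S`.
  have key (S : E →L[𝕜] F) [FiniteDimensional 𝕜 S.ker] [FiniteDimensional 𝕜 (F ⧸ S.range)]
      (e : (M × G) ≃L[𝕜] F) (he : (e : M × G →L[𝕜] F) = J S) :
      S.toLinearMap.index = (LinearMap.inl 𝕜 M G).index - M.subtype.index := by
    have h1 : S.toLinearMap ∘ₗ M.subtype = e.toLinearEquiv.toLinearMap ∘ₗ LinearMap.inl 𝕜 M G := by
      ext m
      have := DFunLike.congr_fun he (m, 0)
      simpa [J] using this.symm
    have : FiniteDimensional 𝕜 e.toLinearEquiv.toLinearMap.ker := by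
      rw [LinearEquiv.ker]
      infer_instance
    have : FiniteDimensional 𝕜 (F ⧸ e.toLinearEquiv.toLinearMap.range) := by
      rw [LinearEquiv.range]
      infer_instance
    have h2 := congrArg LinearMap.index h1
    rw [LinearMap.index_comp, LinearMap.index_comp, LinearEquiv.index_eq_zero] at h2
    linarith
  let e := ContinuousLinearEquiv.ofBijective (J T) hinj hsurj
  have he : (e : M × G →L[𝕜] F) = J T := ContinuousLinearEquiv.coe_ofBijective _ _ _
  have hnhds := hJ.continuousAt.eventually (he ▸ ContinuousLinearEquiv.nhds e)
  filter_upwards [eventually_upper T hc, eventually_lower T, hnhds] with S h1 h2 ⟨e', he'⟩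
  have := h1.1
  have := h2.1
  exact ⟨h1.1, h2.1, (key S e' he').trans (key T e he).symm⟩

end Index

variable {X : Type*} [NormedAddCommGroup X] [NormedSpace ℂ X]

theorem isFredholm_iff_finiteDimensional [CompleteSpace X] (T : X →L[ℂ] X) :
    T.IsFredholm ↔ FiniteDimensional ℂ T.ker ∧ FiniteDimensional ℂ (X ⧸ T.range) := by
  refine ⟨fun h => ⟨h.finite_ker, h.finite_coker⟩, fun ⟨h1, h2⟩ => (isFredholm_iff T).2
    ⟨Or.inr h2, (exists_int_sub_eq_iff _ _ (Or.inl ((nullity_ne_top_iff T).2 h1))).2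
      ⟨(nullity_ne_top_iff T).2 h1, (deficiency_ne_top_iff T).2 h2⟩⟩⟩

theorem index_eq_coe (T : X →L[ℂ] X) [FiniteDimensional ℂ T.ker]
    [FiniteDimensional ℂ (X ⧸ T.range)] : index T = ((T.toLinearMap.index : ℝ) : EReal) := by
  have h1 : nullity T = (Module.finrank ℂ T.ker : ℕ) := by
    rw [nullity, ← Module.finrank_eq_rank, Cardinal.toENat_nat]
  have h2 : deficiency T = (Module.finrank ℂ (X ⧸ T.range) : ℕ) := by
    rw [deficiency, ← Module.finrank_eq_rank, Cardinal.toENat_nat]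
  rw [index, h1, h2, LinearMap.index_eq_finrank_sub]
  push_cast
  rfl

theorem isUpperSemiFredholm_of_isFredholm {T : X →L[ℂ] X} (hT : T.IsFredholm) :
    IsUpperSemiFredholm T :=
  ⟨hT.isClosed_range, hT.finite_ker⟩

theorem isLowerSemiFredholm_of_isFredholm {T : X →L[ℂ] X} (hT : T.IsFredholm) :
    IsLowerSemiFredholm T :=
  hT.finite_coker

/-! ### Comparing reducing pairs through `T - c` -/

section Reduction

variable {T : X →L[ℂ] X} {M N : Submodule ℂ X}

theorem Red.bijective_right_sub (h : Red T M N) [CompleteSpace N]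
    (hq : IsQuasinilpotent h.right) {c : ℂ} (hc : c ≠ 0) :
    Function.Bijective (h.right - c • ContinuousLinearMap.id ℂ N) := by
  have h1 : c ∉ spectrum ℂ h.right := fun hmem => hc (hq hmem)
  rw [spectrum.notMem_iff, ← IsUnit.neg_iff, ContinuousLinearMap.isUnit_iff_bijective] at h1
  convert h1 using 2
  rw [neg_sub, Algebra.algebraMap_eq_smul_one]
  rfl

/-- The kernel of `T - c` is that of `T_M - c`, if `T_N` is quasi-nilpotent and `c ≠ 0`. -/
theorem Red.nonempty_ker_equiv (h : Red T M N) [CompleteSpace N]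
    (hq : IsQuasinilpotent h.right) {c : ℂ} (hc : c ≠ 0) :
    Nonempty ((h.left - c • ContinuousLinearMap.id ℂ M).ker ≃ₗ[ℂ]
      (T - c • ContinuousLinearMap.id ℂ X).ker) := by
  have hmem : ∀ x ∈ (h.left - c • ContinuousLinearMap.id ℂ M).ker,
      M.subtype x ∈ (T - c • ContinuousLinearMap.id ℂ X).ker := fun x hx =>
    congrArg Subtype.val (show (h.left - c • ContinuousLinearMap.id ℂ M) x = 0 from hx)
  refine ⟨LinearEquiv.ofBijective (M.subtype.restrict hmem) ⟨fun x y hxy => ?_, fun ⟨x, hx⟩ => ?_⟩⟩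
  · exact Subtype.ext (Subtype.ext (congrArg (fun z => z.1) hxy))
  · obtain ⟨m, hm, n, hn, rfl⟩ := Submodule.mem_sup.1
      (show x ∈ M ⊔ N by rw [h.isCompl.sup_eq_top]; trivial)
    have hx0 : (T m - c • m) + (T n - c • n) = 0 := by
      have : T (m + n) - c • (m + n) = 0 := hx
      rw [← this, map_add, smul_add]
      abel
    have hM : T m - c • m ∈ M := M.sub_mem (h.mapsTo_left m hm) (M.smul_mem c hm)
    have hN : T n - c • n ∈ N := N.sub_mem (h.mapsTo_right n hn) (N.smul_mem c hn)
    have hm0 : T m - c • m = 0 := by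
      refine Submodule.disjoint_def.1 h.isCompl.disjoint _ hM ?_
      rw [eq_neg_of_add_eq_zero_left hx0]
      exact N.neg_mem hN
    have hn0 : T n - c • n = 0 := by rwa [hm0, zero_add] at hx0
    have hn1 : (⟨n, hn⟩ : N) = 0 :=
      (injective_iff_map_eq_zero _).1 (h.bijective_right_sub hq hc).1 ⟨n, hn⟩ (Subtype.ext hn0)
    have hn2 : n = 0 := congrArg Subtype.val hn1
    subst hn2
    refine ⟨⟨⟨m, hm⟩, Subtype.ext hm0⟩, Subtype.ext ?_⟩
    exact (add_zero m).symm

/-- The cokernel of `T - c` is that of `T_M - c`, if `T_N` is quasi-nilpotent and `c ≠ 0`. -/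
theorem Red.nonempty_coker_equiv (h : Red T M N) [CompleteSpace N]
    (hq : IsQuasinilpotent h.right) {c : ℂ} (hc : c ≠ 0) :
    Nonempty ((M ⧸ (h.left - c • ContinuousLinearMap.id ℂ M).range) ≃ₗ[ℂ]
      (X ⧸ (T - c • ContinuousLinearMap.id ℂ X).range)) := by
  let f : M →ₗ[ℂ] X ⧸ (T - c • ContinuousLinearMap.id ℂ X).range :=
    (T - c • ContinuousLinearMap.id ℂ X).range.mkQ ∘ₗ M.subtype
  have hker : f.ker = (h.left - c • ContinuousLinearMap.id ℂ M).range := by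
    ext x
    rw [LinearMap.mem_ker]
    simp only [f, LinearMap.comp_apply, Submodule.mkQ_apply, Submodule.Quotient.mk_eq_zero]
    constructor
    · rintro ⟨y, hy⟩
      obtain ⟨m, hm, n, hn, rfl⟩ := Submodule.mem_sup.1
        (show y ∈ M ⊔ N by rw [h.isCompl.sup_eq_top]; trivial)
      have hy1 : (T m - c • m) + (T n - c • n) = x := by
        have : T (m + n) - c • (m + n) = x := hy
        rw [← this, map_add, smul_add]
        abel
      have hM : T m - c • m ∈ M := M.sub_mem (h.mapsTo_left m hm) (M.smul_mem c hm)
      have hN : T n - c • n ∈ N := N.sub_mem (h.mapsTo_right n hn) (N.smul_mem c hn)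
      have hn0 : T n - c • n = 0 := by
        refine Submodule.disjoint_def.1 h.isCompl.disjoint _ ?_ hN
        rw [eq_sub_of_add_eq' hy1]
        exact M.sub_mem x.2 hM
      refine ⟨⟨m, hm⟩, Subtype.ext ?_⟩
      rw [hn0, add_zero] at hy1
      exact hy1
    · rintro ⟨y, rfl⟩
      exact ⟨y, rfl⟩
  have hsurj : Function.Surjective f := by
    intro z
    obtain ⟨x, rfl⟩ := Submodule.mkQ_surjective _ z
    obtain ⟨m, hm, n, hn, rfl⟩ := Submodule.mem_sup.1
      (show x ∈ M ⊔ N by rw [h.isCompl.sup_eq_top]; trivial)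
    -- The component in `N` lies in the range of `T - c`, so every class has a representative in
    -- `M`.
    obtain ⟨n', hn'⟩ := (h.bijective_right_sub hq hc).2 ⟨n, hn⟩
    refine ⟨⟨m, hm⟩, ?_⟩
    have hn0 : (T - c • ContinuousLinearMap.id ℂ X).range.mkQ n = 0 :=
      (Submodule.Quotient.mk_eq_zero _).2 ⟨n', congrArg Subtype.val hn'⟩
    rw [map_add, hn0, add_zero]
    rfl
  exact ⟨(Submodule.quotEquivOfEq _ _ hker.symm).trans (f.quotKerEquivOfSurjective hsurj)⟩

theorem tendsto_sub_smul_id (S : X →L[ℂ] X) :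
    Tendsto (fun c : ℂ => S - c • ContinuousLinearMap.id ℂ X) (𝓝[≠] 0) (𝓝 S) := by
  have : Continuous fun c : ℂ => S - c • ContinuousLinearMap.id ℂ X := by fun_prop
  simpa using (this.tendsto 0).mono_left nhdsWithin_le_nhds

variable [CompleteSpace X]

theorem Red.eventually_upper (h : Red T M N) (hM : IsUpperSemiFredholm h.left)
    (hN : IsQuasinilpotent h.right) :
    ∀ᶠ c in 𝓝[≠] (0 : ℂ), FiniteDimensional ℂ (T - c • ContinuousLinearMap.id ℂ X).ker ∧
      (FiniteDimensional ℂ (X ⧸ (T - c • ContinuousLinearMap.id ℂ X).range) →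
        h.left.IsFredholm) := by
  have := h.isClosed_left.completeSpace_coe
  have := h.isClosed_right.completeSpace_coe
  have := hM.finite_ker
  filter_upwards [(tendsto_sub_smul_id h.left).eventually
    (PseudoFredholm.eventually_upper h.left hM.isClosed_range), self_mem_nhdsWithin] with c h1 hc
  obtain ⟨e1⟩ := h.nonempty_ker_equiv hN hc
  obtain ⟨e2⟩ := h.nonempty_coker_equiv hN hc
  have := h1.1
  refine ⟨e1.finiteDimensional, fun h2 => (isFredholm_iff_finiteDimensional _).2
    ⟨hM.finite_ker, h1.2 e2.symm.finiteDimensional⟩⟩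

theorem Red.eventually_lower (h : Red T M N) (hM : IsLowerSemiFredholm h.left)
    (hN : IsQuasinilpotent h.right) :
    ∀ᶠ c in 𝓝[≠] (0 : ℂ),
      FiniteDimensional ℂ (X ⧸ (T - c • ContinuousLinearMap.id ℂ X).range) ∧
      (FiniteDimensional ℂ (T - c • ContinuousLinearMap.id ℂ X).ker → h.left.IsFredholm) := by
  have := h.isClosed_left.completeSpace_coe
  have := h.isClosed_right.completeSpace_coe
  have : FiniteDimensional ℂ (M ⧸ h.left.range) := hM
  filter_upwards [(tendsto_sub_smul_id h.left).eventually
    (PseudoFredholm.eventually_lower h.left), self_mem_nhdsWithin] with c h1 hc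
  obtain ⟨e1⟩ := h.nonempty_ker_equiv hN hc
  obtain ⟨e2⟩ := h.nonempty_coker_equiv hN hc
  have := h1.1
  refine ⟨e2.finiteDimensional, fun h2 => (isFredholm_iff_finiteDimensional _).2
    ⟨h1.2 e1.symm.finiteDimensional, hM⟩⟩

theorem Red.eventually_index_eq (h : Red T M N) (hM : h.left.IsFredholm)
    (hN : IsQuasinilpotent h.right) :
    ∀ᶠ c in 𝓝[≠] (0 : ℂ), index h.left =
      (((T - c • ContinuousLinearMap.id ℂ X).toLinearMap.index : ℝ) : EReal) := by
  have := h.isClosed_left.completeSpace_coe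
  have := h.isClosed_right.completeSpace_coe
  obtain ⟨hk, hr⟩ := (isFredholm_iff_finiteDimensional _).1 hM
  filter_upwards [(tendsto_sub_smul_id h.left).eventually
    (PseudoFredholm.eventually_index_eq h.left hM.isClosed_range), self_mem_nhdsWithin]
    with c h1 hc
  obtain ⟨e1⟩ := h.nonempty_ker_equiv hN hc
  obtain ⟨e2⟩ := h.nonempty_coker_equiv hN hc
  rw [index_eq_coe, ← h1.2.2, LinearMap.index_eq_finrank_sub, LinearMap.index_eq_finrank_sub,
    e1.finrank_eq, e2.finrank_eq]

/-- Punctured neighbourhoods of `0` in `ℂ` are nonempty, so one `c` serves both pairs: each supplies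
the finiteness that the other lacks. -/
theorem Red.isFredholm_of_upper_of_lower {M' N' : Submodule ℂ X} (h : Red T M N)
    (hM : IsUpperSemiFredholm h.left) (hN : IsQuasinilpotent h.right) (h' : Red T M' N')
    (hM' : IsLowerSemiFredholm h'.left) (hN' : IsQuasinilpotent h'.right) :
    h.left.IsFredholm ∧ h'.left.IsFredholm := by
  obtain ⟨c, hc1, hc2⟩ := ((h.eventually_upper hM hN).and (h'.eventually_lower hM' hN')).exists
  exact ⟨hc1.2 hc2.1, hc2.2 hc1.1⟩

theorem Red.index_eq_index {M' N' : Submodule ℂ X} (h : Red T M N)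
    (hM : h.left.IsFredholm) (hN : IsQuasinilpotent h.right) (h' : Red T M' N')
    (hM' : h'.left.IsFredholm) (hN' : IsQuasinilpotent h'.right) :
    index h.left = index h'.left := by
  obtain ⟨c, hc1, hc2⟩ :=
    ((h.eventually_index_eq hM hN).and (h'.eventually_index_eq hM' hN')).exists
  rw [hc1, hc2]

end Reduction

end PseudoFredholm

/-! ### The three equivalences -/

open PseudoFredholm in
theorem mainTheorem10 {X : Type*} [NormedAddCommGroup X] [NormedSpace ℂ X] [CompleteSpace X]
    (T : X →L[ℂ] X) :
    (PseudoFredholm.IsPseudoBFredholm T ↔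
      PseudoFredholm.IsUpperPseudoSemiBFredholm T ∧ PseudoFredholm.IsLowerPseudoSemiBFredholm T) ∧
    (PseudoFredholm.IsPseudoBWeyl T ↔
      PseudoFredholm.IsUpperPseudoSemiBWeyl T ∧ PseudoFredholm.IsLowerPseudoSemiBWeyl T) ∧
    (PseudoFredholm.IsPseudoBFredholm T ↔
      ∃ hT : PseudoFredholm.IsPseudoSemiBFredholm T,
        ∃ n : ℤ, PseudoFredholm.pseudoIndex T hT = ((n : ℝ) : EReal)) := by
  refine ⟨⟨?_, ?_⟩, ⟨?_, ?_⟩, ⟨?_, ?_⟩⟩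
  · rintro ⟨M, N, h, hM, hN⟩
    exact ⟨⟨M, N, h, isUpperSemiFredholm_of_isFredholm hM, hN⟩,
      ⟨M, N, h, isLowerSemiFredholm_of_isFredholm hM, hN⟩⟩
  · rintro ⟨⟨M, N, h, hM, hN⟩, ⟨M', N', h', hM', hN'⟩⟩
    exact ⟨M, N, h, (h.isFredholm_of_upper_of_lower hM hN h' hM' hN').1, hN⟩
  · rintro ⟨M, N, h, ⟨hM, h0⟩, hN⟩
    exact ⟨⟨M, N, h, ⟨isUpperSemiFredholm_of_isFredholm hM, h0.le⟩, hN⟩,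
      ⟨M, N, h, ⟨isLowerSemiFredholm_of_isFredholm hM, h0.ge⟩, hN⟩⟩
  · rintro ⟨⟨M, N, h, ⟨hM, h0⟩, hN⟩, ⟨M', N', h', ⟨hM', h0'⟩, hN'⟩⟩
    obtain ⟨hF, hF'⟩ := h.isFredholm_of_upper_of_lower hM hN h' hM' hN'
    refine ⟨M, N, h, ⟨hF, h0.antisymm ?_⟩, hN⟩
    rwa [h.index_eq_index hF hN h' hF' hN']
  · rintro ⟨M, N, h, hM, hN⟩
    have hT : IsPseudoSemiBFredholm T :=
      Or.inl ⟨M, N, h, isUpperSemiFredholm_of_isFredholm hM, hN⟩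
    refine ⟨hT, ?_⟩
    -- The pair chosen in `pseudoIndex` may differ from `(M, N)`. Its left part is upper or lower
    -- semi-Fredholm, and `(M, N)` plays the opposite role in the comparison.
    have hs := hT.exists_red.choose_spec.choose_spec.choose_spec
    have := hT.exists_red.choose_spec.choose_spec.choose.isClosed_left.completeSpace_coe
    refine ((isFredholm_iff _).1 ?_).2
    rcases hs.1 with h1 | h1
    · exact (Red.isFredholm_of_upper_of_lower _ h1 hs.2 h
        (isLowerSemiFredholm_of_isFredholm hM) hN).1
    · exact (h.isFredholm_of_upper_of_lower (isUpperSemiFredholm_of_isFredholm hM) hN _ h1 hs.2).2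
  · rintro ⟨hT, hn⟩
    have hs := hT.exists_red.choose_spec.choose_spec.choose_spec
    have := hT.exists_red.choose_spec.choose_spec.choose.isClosed_left.completeSpace_coe
    exact ⟨_, _, _, (isFredholm_iff _).2 ⟨hs.1, hn⟩, hs.2⟩
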